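/- Let $k\in\mathbb{N}$, let $R=[r^1,\dots,r^k]\in\mathbb{Q}^{2\times k}$ have non-zero columns, let $f\in\mathbb{Q}^2\setminus\mathbb{Z}^2$, and assume that $$P(R,f):=\{(x,s)\in\mathbb{Z}^2\times\mathbb{R}^k_{+} \mid f+Rs=x\}$$ is non-empty. Let $P(R,f)^0:=\{(x,s)\in\mathbb{R}^2\times\mathbb{R}^k_{+}\mid f+Rs=x\}$ be its linear programming relaxation. For a set $C\subseteq\mathbb{R}^2\times\mathbb{R}^k$, the split closure of $C$ is $$\bigcap_{\pi\in\mathbb{Z}^2,\ \pi_0\in\mathbb{Z}}\operatorname{conv}\Big(\big(C\cap\{(x,s)\mid\pi^Tx\le\pi_0\}\big)\cup\big(C\cap\{(x,s)\mid\pi^Tx\ge\pi_0+1\}\big)\Big).$$ Let $P(R,f)^{n}$ be the set obtained from $P(R,f)^0$ by taking the split closure $n$ times. The split rank of a linear inequality (with respect to $P(R,f)^0$) is the smallest $n\ge 0$ such that the inequality is valid for $P(R,f)^{n}$; it is $+\infty$ if there is no such $n$. For $\alpha\in\mathbb{R}^k_{+}$, the set induced by the inequality $\sum_{i=1}^k\alpha_is_i\ge1$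 is $$L_\alpha:=\operatorname{conv}\Big(\Big\{f+\frac{r^i}{\alpha_i}\ \Big|\ \alpha_i>0\Big\}\cup\{f\}\Big)+\operatorname{cone}\{r^i\mid\alpha_i=0\}.$$ A (non-degenerate) triangle $T\subset\mathbb{R}^2$ is of type $T^{2A}$ if its interior contains no point of $\mathbb{Z}^2$ and it has a vertex $v\notin\mathbb{Z}^2$ such that the side opposite to $v$ contains at least two integer points (end points included) and each of the two sides incident to $v$ contains exactly one integer point in its relative interior. Then the following holds. If $\alpha\in\mathbb{R}^k_{+}$ is such that the inequality $\sum_{i=1}^k\alpha_is_i\ge1$ is valid for $\operatorname{conv}(P(R,f))$ and $L_\alpha$ is a triangle of type $T^{2A}$, then the split rank of $\sum_{i=1}^k\alpha_is_i\ge1$ with respect to $P(R,f)^0$ is finite. -/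

import Mathlib

open scoped Pointwise

/-- The points of `ℝᵈ` all of whose coordinates are integers. -/
def integerPoints (d : ℕ) : Set (Fin d → ℝ) :=
  {x | ∀ i, ∃ n : ℤ, x i = (n : ℝ)}

/-- The inequality `aᵀx + bᵀy ≤ c` is valid for the set `C` of points `(x, y)`. -/
def IsValidIneq {p q : ℕ} (C : Set ((Fin p → ℝ) × (Fin q → ℝ)))
    (a : Fin p → ℝ) (b : Fin q → ℝ) (c : ℝ) : Prop :=
  ∀ z ∈ C, ∑ i, a i * z.1 i + ∑ j, b j * z.2 j ≤ c

/-- Convex hull of the points of `C` that satisfy the disjunction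
`πᵀx ≤ π₀` or `πᵀx ≥ π₀ + 1`. -/
def splitHull {p q : ℕ} (C : Set ((Fin p → ℝ) × (Fin q → ℝ)))
    (π : Fin p → ℤ) (π₀ : ℤ) : Set ((Fin p → ℝ) × (Fin q → ℝ)) :=
  convexHull ℝ
    ((C ∩ {z | ∑ i, (π i : ℝ) * z.1 i ≤ (π₀ : ℝ)}) ∪
      (C ∩ {z | (π₀ : ℝ) + 1 ≤ ∑ i, (π i : ℝ) * z.1 i}))

/-- The split closure of `C`: the intersection of the hulls over all split disjunctions. -/
def splitClosure {p q : ℕ} (C : Set ((Fin p → ℝ) × (Fin q → ℝ))) :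
    Set ((Fin p → ℝ) × (Fin q → ℝ)) :=
  ⋂ (π : Fin p → ℤ) (π₀ : ℤ), splitHull C π π₀

/-- The split rank of `aᵀx + bᵀy ≤ c` with respect to `C`: the least `n` such that the
inequality is valid for the `n`-th split closure of `C`, and `⊤` if there is none. -/
noncomputable def splitRank {p q : ℕ} (C : Set ((Fin p → ℝ) × (Fin q → ℝ)))
    (a : Fin p → ℝ) (b : Fin q → ℝ) (c : ℝ) : ℕ∞ :=
  ⨅ (n : ℕ) (_ : IsValidIneq (splitClosure^[n] C) a b c), (n : ℕ∞)

/-- The linear relaxation `{(x, s) ∈ ℝ² × ℝᵏ | f + R s = x, s ≥ 0}` of `P(R, f)`. -/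
def relaxation {k : ℕ} (R : Matrix (Fin 2) (Fin k) ℚ) (f : Fin 2 → ℚ) :
    Set ((Fin 2 → ℝ) × (Fin k → ℝ)) :=
  {z | (∀ i, (f i : ℝ) + ∑ j, (R i j : ℝ) * z.2 j = z.1 i) ∧ ∀ j, 0 ≤ z.2 j}

/-- The mixed integer set `P(R, f) = {(x, s) ∈ ℤ² × ℝᵏ | f + R s = x, s ≥ 0}`. -/
def mixedIntegerSet {k : ℕ} (R : Matrix (Fin 2) (Fin k) ℚ) (f : Fin 2 → ℚ) :
    Set ((Fin 2 → ℝ) × (Fin k → ℝ)) :=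
  {z | z ∈ relaxation R f ∧ z.1 ∈ integerPoints 2}

/-- The rational point `f`, as a point of `ℝ²`. -/
def realPoint (f : Fin 2 → ℚ) : Fin 2 → ℝ := fun i => (f i : ℝ)

/-- The `j`-th column `rʲ` of `R`, as a vector of `ℝ²`. -/
def column {k : ℕ} (R : Matrix (Fin 2) (Fin k) ℚ) (j : Fin k) : Fin 2 → ℝ :=
  fun i => (R i j : ℝ)

/-- The set `L_α = conv({f + rʲ/αⱼ | αⱼ > 0} ∪ {f}) + cone{rʲ | αⱼ = 0}` induced by the
inequality `∑ αⱼ sⱼ ≥ 1`, for `α ≥ 0`. -/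
def inducedSet {k : ℕ} (R : Matrix (Fin 2) (Fin k) ℚ) (f : Fin 2 → ℚ) (α : Fin k → ℝ) :
    Set (Fin 2 → ℝ) :=
  convexHull ℝ
      ({y | ∃ j, 0 < α j ∧ y = realPoint f + (α j)⁻¹ • column R j} ∪ {realPoint f}) +
    {y | ∃ c : Fin k → ℝ, (∀ j, 0 ≤ c j) ∧ (∀ j, α j ≠ 0 → c j = 0) ∧
      y = ∑ j, c j • column R j}

/-- No integer point lies in the interior of `S`. -/
def IsLatticeFree (S : Set (Fin 2 → ℝ)) : Prop :=
  interior S ∩ integerPoints 2 = ∅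

/-- Triangles of type `T^{2A}`: lattice-free, with a non-integral vertex `v` whose opposite
side contains at least two integer points (end points count), while each of the two sides at
`v` contains exactly one integer point in its relative interior. -/
def IsTriangleT2A (T : Set (Fin 2 → ℝ)) : Prop :=
  IsLatticeFree T ∧
  ∃ v a b : Fin 2 → ℝ,
    AffineIndependent ℝ ![v, a, b] ∧
    T = convexHull ℝ {v, a, b} ∧
    v ∉ integerPoints 2 ∧
    (segment ℝ a b ∩ integerPoints 2).Nontrivial ∧
    (∃! p, p ∈ openSegment ℝ v a ∩ integerPoints 2) ∧
    (∃! p, p ∈ openSegment ℝ v b ∩ integerPoints 2)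

/-!
The affine functionals `φ` for which `φ(x) ≤ αᵀs` has finite split rank form a convex set, and a
split on a lattice functional `u` proves such a bound as soon as it is dominated by one known
bound where `u ≤ 0` and by another one where `1 ≤ u`. The three sides of `L_α` provide the first
bounds: each side has an integer point in its relative interior, so by validity `f` lies on no side,
and scaling the side functionals to the value `1` at `f` gives bounds of rank `0`.

In suitable unimodular coordinates `(X, Y)` the triangle has its base on `Y = 0`, and its other
sides run through `(-p, 0)`, `(0, 1)` and through `(1 + q, 0)`, `(1, 1)`, with `p, q > 0`. A bound
that is constant on `Y = 1`, non-decreasing in `Y` and dominated by the left side where `X ≤ 0`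
and by the right side where `1 ≤ X` is obtained by a split on `X`; a split on `Y` against the base
then turns it into a constant bound. If both sides have the same slope in `Y` this constant is `1`.
If not, mixing the sides with a known constant bound `1 - ε` equalizes the slopes, at the cost of
reaching only `1 - (1 - τ) ε`; iterating, every constant below `1` is reached. Finally `p` and `q`
are rational, so multiples of the side functionals are lattice functionals, and a split on such a
multiple, with a constant close to `1` on the far side, flattens a side bound to any smaller slope.
This makes the two slopes equal.
-/

open AffineMap Filter Set
open scoped Matrix

section SplitBounds

variable {d k : ℕ} {C : Set ((Fin d → ℝ) × (Fin k → ℝ))} {w : Fin k → ℝ}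
  {u φ ψ ψ' : (Fin d → ℝ) →ᵃ[ℝ] ℝ}

/-- An affine functional `x ↦ πᵀx + π₀` with integral `π` and `π₀`, encoded without coefficients:
it takes integer values at the integer points. -/
def IsLatticeFunctional (u : (Fin d → ℝ) →ᵃ[ℝ] ℝ) : Prop :=
  ∀ x ∈ integerPoints d, ∃ m : ℤ, u x = m

theorem affineMap_apply_eq_sum (u : (Fin d → ℝ) →ᵃ[ℝ] ℝ) (x : Fin d → ℝ) :
    u x = ∑ i, (u (Pi.single i 1) - u 0) * x i + u 0 := by
  have hlin : ∀ y, u.linear y = u y - u 0 := fun y => by simpa using u.linearMap_vsub y 0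
  rw [← sub_eq_iff_eq_add, ← hlin, LinearMap.pi_apply_eq_sum_univ u.linear x]
  refine Finset.sum_congr rfl fun i _ => ?_
  rw [← hlin, smul_eq_mul, mul_comm]
  congr 2
  ext j
  simp [Pi.single_apply, eq_comm]

theorem IsLatticeFunctional.exists_coeff (hu : IsLatticeFunctional u) :
    ∃ (π : Fin d → ℤ) (π₀ : ℤ), ∀ x, u x = ∑ i, (π i : ℝ) * x i + π₀ := by
  obtain ⟨π₀, hπ₀⟩ := hu 0 fun i => ⟨0, by simp⟩
  have hbasis : ∀ i, ∃ m : ℤ, u (Pi.single i 1) = m := fun i =>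
    hu _ fun j => ⟨(Pi.single i 1 : Fin d → ℤ) j, by simp [Pi.single_apply]⟩
  choose m hm using hbasis
  refine ⟨fun i => m i - π₀, π₀, fun x => ?_⟩
  rw [affineMap_apply_eq_sum u x]
  simp [hm, hπ₀]

/-- The affine functionals `φ` for which the inequality `φ(x) ≤ wᵀs` has finite split rank
with respect to `C`. -/
def finiteRankBounds (C : Set ((Fin d → ℝ) × (Fin k → ℝ))) (w : Fin k → ℝ) :
    Set ((Fin d → ℝ) →ᵃ[ℝ] ℝ) :=
  {φ | ∃ n : ℕ, ∀ z ∈ splitClosure^[n] C, φ z.1 ≤ w ⬝ᵥ z.2}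

theorem splitRank_lt_top_of_const_mem {c : ℝ} (h : const ℝ _ c ∈ finiteRankBounds C w) :
    splitRank C 0 (-w) (-c) < ⊤ := by
  obtain ⟨n, hn⟩ := h
  refine (iInf₂_le n fun z hz => ?_).trans_lt (ENat.natCast_lt_top n)
  simpa [dotProduct] using hn z hz

theorem convex_setOf_apply_fst_le_dotProduct_snd (φ : (Fin d → ℝ) →ᵃ[ℝ] ℝ) (w : Fin k → ℝ) :
    Convex ℝ {z : (Fin d → ℝ) × (Fin k → ℝ) | φ z.1 ≤ w ⬝ᵥ z.2} := by
  intro y hy z hz s t hs ht hst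
  simp only [mem_ofPred_eq, Prod.fst_add, Prod.snd_add, Prod.smul_fst, Prod.smul_snd,
    Convex.combo_affine_apply hst, dotProduct_add, dotProduct_smul] at hy hz ⊢
  gcongr

theorem splitClosure_subset_convexHull_of_isLatticeFunctional (hu : IsLatticeFunctional u) :
    splitClosure C ⊆ convexHull ℝ (C ∩ {z | u z.1 ≤ 0} ∪ C ∩ {z | 1 ≤ u z.1}) := by
  obtain ⟨π, π₀, hπ⟩ := hu.exists_coeff
  have hle : ∀ t : ℝ, t + π₀ ≤ 0 ↔ t ≤ (-π₀ : ℤ) := fun t => by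
    push_cast; constructor <;> intro h <;> linarith
  have hge : ∀ t : ℝ, 1 ≤ t + π₀ ↔ ((-π₀ : ℤ) : ℝ) + 1 ≤ t := fun t => by
    push_cast; constructor <;> intro h <;> linarith
  simp only [hπ, hle, hge]
  intro z hz
  exact mem_iInter₂.1 hz π (-π₀)

theorem apply_fst_le_dotProduct_snd_of_mem_splitClosure (hu : IsLatticeFunctional u)
    (hnonpos : ∀ z ∈ C, u z.1 ≤ 0 → φ z.1 ≤ w ⬝ᵥ z.2)
    (hone : ∀ z ∈ C, 1 ≤ u z.1 → φ z.1 ≤ w ⬝ᵥ z.2) :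
    ∀ z ∈ splitClosure C, φ z.1 ≤ w ⬝ᵥ z.2 := by
  intro z hz
  have hz' := splitClosure_subset_convexHull_of_isLatticeFunctional hu hz
  refine convexHull_min ?_ (convex_setOf_apply_fst_le_dotProduct_snd φ w) hz'
  rintro y (⟨hy, hy'⟩ | ⟨hy, hy'⟩)
  exacts [hnonpos y hy hy', hone y hy hy']

theorem eventually_of_mem_finiteRankBounds (hφ : φ ∈ finiteRankBounds C w) :
    ∀ᶠ n in atTop, ∀ z ∈ splitClosure^[n] C, φ z.1 ≤ w ⬝ᵥ z.2 := by
  obtain ⟨n₀, hn₀⟩ := hφ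
  refine eventually_atTop.2 ⟨n₀, fun n hn => ?_⟩
  induction n, hn using Nat.le_induction with
  | base => exact hn₀
  | succ n _ ih =>
    rw [Function.iterate_succ_apply']
    exact apply_fst_le_dotProduct_snd_of_mem_splitClosure (u := 0) (fun _ _ => ⟨0, by simp⟩)
      (fun z hz _ => ih z hz) fun z hz _ => ih z hz

theorem convex_finiteRankBounds : Convex ℝ (finiteRankBounds C w) := by
  intro φ hφ ψ hψ s t hs ht hst
  obtain ⟨n, hφn, hψn⟩ :=
    ((eventually_of_mem_finiteRankBounds hφ).and (eventually_of_mem_finiteRankBounds hψ)).exists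
  refine ⟨n, fun z hz => ?_⟩
  calc s * φ z.1 + t * ψ z.1 ≤ s * (w ⬝ᵥ z.2) + t * (w ⬝ᵥ z.2) := by
        gcongr <;> [exact hφn z hz; exact hψn z hz]
    _ = w ⬝ᵥ z.2 := by rw [← add_mul, hst, one_mul]

theorem mem_finiteRankBounds_of_split (hu : IsLatticeFunctional u)
    (hψ : ψ ∈ finiteRankBounds C w) (hψ' : ψ' ∈ finiteRankBounds C w)
    (hnonpos : ∀ x, u x ≤ 0 → φ x ≤ ψ x) (hone : ∀ x, 1 ≤ u x → φ x ≤ ψ' x) :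
    φ ∈ finiteRankBounds C w := by
  obtain ⟨n, hψn, hψ'n⟩ :=
    ((eventually_of_mem_finiteRankBounds hψ).and (eventually_of_mem_finiteRankBounds hψ')).exists
  refine ⟨n + 1, ?_⟩
  rw [Function.iterate_succ_apply']
  exact apply_fst_le_dotProduct_snd_of_mem_splitClosure hu
    (fun z hz hz' => (hnonpos _ hz').trans (hψn z hz))
    fun z hz hz' => (hone _ hz').trans (hψ'n z hz)

end SplitBounds

section TriangleBounds

variable {d k : ℕ} {C : Set ((Fin d → ℝ) × (Fin k → ℝ))} {w : Fin k → ℝ}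
  {X Y u : (Fin d → ℝ) →ᵃ[ℝ] ℝ}

theorem const_mem_finiteRankBounds_of_split_split (hX : IsLatticeFunctional X)
    (hY : IsLatticeFunctional Y) {c κ μ : ℝ} (hc : 0 ≤ c) (hκ : 0 ≤ κ) (hμ : μ ≤ 1)
    (hbase : const ℝ _ 1 - c • Y ∈ finiteRankBounds C w) {ψ ψ' : (Fin d → ℝ) →ᵃ[ℝ] ℝ}
    (hψ : ψ ∈ finiteRankBounds C w) (hψ' : ψ' ∈ finiteRankBounds C w)
    (hnonpos : ∀ x, X x ≤ 0 → μ - κ * (1 - Y x) ≤ ψ x)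
    (hone : ∀ x, 1 ≤ X x → μ - κ * (1 - Y x) ≤ ψ' x) :
    const ℝ _ μ ∈ finiteRankBounds C w := by
  have hincreasing : const ℝ _ μ - κ • (const ℝ _ 1 - Y) ∈ finiteRankBounds C w :=
    mem_finiteRankBounds_of_split hX hψ hψ' (by simpa using hnonpos) (by simpa using hone)
  refine mem_finiteRankBounds_of_split hY hbase hincreasing (fun x hx => ?_) fun x hx => ?_
  · have := mul_nonpos_of_nonneg_of_nonpos hc hx
    simpa using by linarith
  · have := mul_nonpos_of_nonneg_of_nonpos hκ (sub_nonpos.2 hx)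
    simpa using by linarith

/-- The side of a triangle with base on `Y = 0` that runs through the points with `(X, Y)`
equal to `(-p, 0)` and `(0, 1)`; the functional is positive to the right of the side. -/
def leftSide (X Y : (Fin d → ℝ) →ᵃ[ℝ] ℝ) (p : ℝ) : (Fin d → ℝ) →ᵃ[ℝ] ℝ :=
  X + p • (const ℝ _ 1 - Y)

/-- The side of a triangle with base on `Y = 0` that runs through the points with `(X, Y)`
equal to `(1 + q, 0)` and `(1, 1)`; the functional is positive to the left of the side. -/
def rightSide (X Y : (Fin d → ℝ) →ᵃ[ℝ] ℝ) (q : ℝ) : (Fin d → ℝ) →ᵃ[ℝ] ℝ :=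
  leftSide (const ℝ _ 1 - X) Y q

@[simp]
theorem leftSide_apply (X Y : (Fin d → ℝ) →ᵃ[ℝ] ℝ) (p : ℝ) (x : Fin d → ℝ) :
    leftSide X Y p x = X x + p * (1 - Y x) := by
  simp [leftSide]

@[simp]
theorem rightSide_apply (X Y : (Fin d → ℝ) →ᵃ[ℝ] ℝ) (q : ℝ) (x : Fin d → ℝ) :
    rightSide X Y q x = 1 - X x + q * (1 - Y x) := by
  simp [rightSide]

theorem isLatticeFunctional_den_smul_leftSide (hX : IsLatticeFunctional X)
    (hY : IsLatticeFunctional Y) (p : ℚ) :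
    IsLatticeFunctional ((p.den : ℝ) • leftSide X Y p) := by
  intro x hx
  obtain ⟨m, hm⟩ := hX x hx
  obtain ⟨n, hn⟩ := hY x hx
  have hp : (p.den : ℝ) * p = p.num := mod_cast Rat.den_mul_eq_num p
  refine ⟨p.den * m + p.num * (1 - n), ?_⟩
  simp only [coe_smul, Pi.smul_apply, leftSide_apply, hm, hn, smul_eq_mul]
  push_cast
  linear_combination (1 - n : ℝ) * hp

theorem IsLatticeFunctional.one_sub (hX : IsLatticeFunctional X) :
    IsLatticeFunctional (const ℝ _ 1 - X) := by
  intro x hx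
  obtain ⟨m, hm⟩ := hX x hx
  exact ⟨1 - m, by simp [hm]⟩

theorem isLatticeFunctional_den_smul_rightSide (hX : IsLatticeFunctional X)
    (hY : IsLatticeFunctional Y) (q : ℚ) :
    IsLatticeFunctional ((q.den : ℝ) • rightSide X Y q) :=
  isLatticeFunctional_den_smul_leftSide hX.one_sub hY q

theorem const_mem_finiteRankBounds_improve (hX : IsLatticeFunctional X)
    (hY : IsLatticeFunctional Y) {p q c₁ c₂ c₃ : ℝ} (hp : 0 < p) (hq : 0 < q) (hc₁ : 0 < c₁)
    (hc₂ : 0 < c₂) (hc₃ : 0 ≤ c₃)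
    (hleft : const ℝ _ 1 - c₁ • leftSide X Y p ∈ finiteRankBounds C w)
    (hright : const ℝ _ 1 - c₂ • rightSide X Y q ∈ finiteRankBounds C w)
    (hbase : const ℝ _ 1 - c₃ • Y ∈ finiteRankBounds C w) :
    ∃ τ : ℝ, 0 < τ ∧ τ ≤ 1 ∧ ∀ ε : ℝ, 0 ≤ ε → const ℝ _ (1 - ε) ∈ finiteRankBounds C w →
      const ℝ _ (1 - (1 - τ) * ε) ∈ finiteRankBounds C w := by
  -- Mixing the side bounds with the constant in the proportions `t₁` and `t₂` gives both
  -- of them the same slope in `Y`.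
  obtain ⟨t₁, t₂, ht₁, ht₂, hsum, hslope⟩ : ∃ t₁ t₂ : ℝ, 0 < t₁ ∧ 0 < t₂ ∧ t₁ + t₂ = 1 ∧
      t₁ * (c₁ * p) = t₂ * (c₂ * q) := by
    refine ⟨c₂ * q / (c₁ * p + c₂ * q), c₁ * p / (c₁ * p + c₂ * q), by positivity, by positivity,
      ?_, ?_⟩ <;> field_simp
    ring
  refine ⟨min t₁ t₂, lt_min ht₁ ht₂, (min_le_left _ _).trans (by linarith), fun ε hε hconst => ?_⟩
  have hmin₁ := mul_le_mul_of_nonneg_right (min_le_left t₁ t₂) hε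
  have hmin₂ := mul_le_mul_of_nonneg_right (min_le_right t₁ t₂) hε
  have hmin : min t₁ t₂ ≤ 1 := (min_le_left _ _).trans (by linarith)
  refine const_mem_finiteRankBounds_of_split_split (κ := t₁ * (c₁ * p)) hX hY hc₃ (by positivity)
    (sub_le_self _ (mul_nonneg (sub_nonneg.2 hmin) hε)) hbase
    (convex_finiteRankBounds hleft hconst ht₁.le ht₂.le hsum)
    (convex_finiteRankBounds hright hconst ht₂.le ht₁.le (by rwa [add_comm]))
    (fun x hx => ?_) fun x hx => ?_
  · have : t₁ * c₁ * X x ≤ 0 := mul_nonpos_of_nonneg_of_nonpos (by positivity) hx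
    simp only [coe_add, coe_sub, coe_smul, Pi.add_apply, Pi.sub_apply, Pi.smul_apply, const_apply,
      leftSide_apply, smul_eq_mul]
    linear_combination this + hmin₁ + (ε - 1) * hsum
  · have : t₂ * c₂ * (1 - X x) ≤ 0 :=
      mul_nonpos_of_nonneg_of_nonpos (by positivity) (sub_nonpos.2 hx)
    simp only [coe_add, coe_sub, coe_smul, Pi.add_apply, Pi.sub_apply, Pi.smul_apply, const_apply,
      rightSide_apply, smul_eq_mul]
    linear_combination this + hmin₂ + (ε - 1) * hsum - (1 - Y x) * hslope

theorem const_mem_finiteRankBounds_of_lt_one (hX : IsLatticeFunctional X)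
    (hY : IsLatticeFunctional Y) {p q c₁ c₂ c₃ : ℝ} (hp : 0 < p) (hq : 0 < q) (hc₁ : 0 < c₁)
    (hc₂ : 0 < c₂) (hc₃ : 0 ≤ c₃) (hzero : const ℝ _ 0 ∈ finiteRankBounds C w)
    (hleft : const ℝ _ 1 - c₁ • leftSide X Y p ∈ finiteRankBounds C w)
    (hright : const ℝ _ 1 - c₂ • rightSide X Y q ∈ finiteRankBounds C w)
    (hbase : const ℝ _ 1 - c₃ • Y ∈ finiteRankBounds C w) {μ : ℝ} (hμ : μ < 1) :
    const ℝ _ μ ∈ finiteRankBounds C w := by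
  obtain ⟨τ, hτ, hτ', himprove⟩ :=
    const_mem_finiteRankBounds_improve hX hY hp hq hc₁ hc₂ hc₃ hleft hright hbase
  have hpow : ∀ n : ℕ, const ℝ _ (1 - (1 - τ) ^ n) ∈ finiteRankBounds C w := by
    intro n
    induction n with
    | zero => simpa using hzero
    | succ n ih => simpa [pow_succ'] using himprove _ (pow_nonneg (sub_nonneg.2 hτ') n) ih
  obtain ⟨n, hn⟩ := exists_pow_lt_of_lt_one (sub_pos.2 hμ) (sub_lt_self 1 hτ)
  obtain ⟨m, hm⟩ := hpow n
  exact ⟨m, fun z hz => (show μ ≤ 1 - (1 - τ) ^ n by linarith).trans (hm z hz)⟩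

theorem const_sub_smul_mem_finiteRankBounds_of_le {N : ℝ} (hN : 0 < N)
    (hu : IsLatticeFunctional (N • u)) {c c' : ℝ} (hc' : 0 < c') (hle : c' ≤ c)
    (hconst : ∀ μ < 1, const ℝ _ μ ∈ finiteRankBounds C w)
    (hside : const ℝ _ 1 - c • u ∈ finiteRankBounds C w) :
    const ℝ _ 1 - c' • u ∈ finiteRankBounds C w := by
  refine mem_finiteRankBounds_of_split hu hside
    (hconst (1 - c' / N) (sub_lt_self 1 (by positivity))) (fun x hx => ?_) fun x hx => ?_
  · have hux : u x ≤ 0 := nonpos_of_mul_nonpos_right hx hN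
    simp only [coe_sub, coe_smul, Pi.sub_apply, Pi.smul_apply, const_apply, smul_eq_mul]
    linarith [mul_le_mul_of_nonpos_right hle hux]
  · have hux : 1 / N ≤ u x := by rw [div_le_iff₀' hN]; exact hx
    simp only [coe_sub, coe_smul, Pi.sub_apply, Pi.smul_apply, const_apply, smul_eq_mul]
    linarith [mul_le_mul_of_nonneg_left hux hc'.le, div_eq_mul_one_div c' N]

theorem const_one_mem_finiteRankBounds (hX : IsLatticeFunctional X)
    (hY : IsLatticeFunctional Y) {p q : ℚ} (hp : 0 < p) (hq : 0 < q) {c₁ c₂ c₃ : ℝ}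
    (hc₁ : 0 < c₁) (hc₂ : 0 < c₂) (hc₃ : 0 ≤ c₃) (hzero : const ℝ _ 0 ∈ finiteRankBounds C w)
    (hleft : const ℝ _ 1 - c₁ • leftSide X Y p ∈ finiteRankBounds C w)
    (hright : const ℝ _ 1 - c₂ • rightSide X Y q ∈ finiteRankBounds C w)
    (hbase : const ℝ _ 1 - c₃ • Y ∈ finiteRankBounds C w) :
    const ℝ _ 1 ∈ finiteRankBounds C w := by
  have hp' : (0 : ℝ) < p := mod_cast hp
  have hq' : (0 : ℝ) < q := mod_cast hq
  have hconst : ∀ μ < 1, const ℝ _ μ ∈ finiteRankBounds C w := fun _ =>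
    const_mem_finiteRankBounds_of_lt_one hX hY hp' hq' hc₁ hc₂ hc₃ hzero hleft hright hbase
  obtain ⟨κ, hκ, hκ₁, hκ₂⟩ : ∃ κ : ℝ, 0 < κ ∧ κ ≤ c₁ * p ∧ κ ≤ c₂ * q :=
    ⟨min (c₁ * p) (c₂ * q), by positivity, min_le_left _ _, min_le_right _ _⟩
  have hleft' : const ℝ _ 1 - (κ / p : ℝ) • leftSide X Y p ∈ finiteRankBounds C w :=
    const_sub_smul_mem_finiteRankBounds_of_le (Nat.cast_pos.2 p.den_pos)
      (isLatticeFunctional_den_smul_leftSide hX hY p) (by positivity) ((div_le_iff₀ hp').2 hκ₁)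
      hconst hleft
  have hright' : const ℝ _ 1 - (κ / q : ℝ) • rightSide X Y q ∈ finiteRankBounds C w :=
    const_sub_smul_mem_finiteRankBounds_of_le (Nat.cast_pos.2 q.den_pos)
      (isLatticeFunctional_den_smul_rightSide hX hY q) (by positivity) ((div_le_iff₀ hq').2 hκ₂)
      hconst hright
  refine const_mem_finiteRankBounds_of_split_split (κ := κ) hX hY hc₃ hκ.le le_rfl hbase
    hleft' hright' (fun x hx => ?_) fun x hx => ?_
  · have : κ / p * X x ≤ 0 := mul_nonpos_of_nonneg_of_nonpos (by positivity) hx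
    simp only [coe_sub, coe_smul, Pi.sub_apply, Pi.smul_apply, const_apply, leftSide_apply,
      smul_eq_mul, mul_add, ← mul_assoc, div_mul_cancel₀ κ hp'.ne']
    linarith
  · have : κ / q * (1 - X x) ≤ 0 :=
      mul_nonpos_of_nonneg_of_nonpos (by positivity) (sub_nonpos.2 hx)
    simp only [coe_sub, coe_smul, Pi.sub_apply, Pi.smul_apply, const_apply, rightSide_apply,
      smul_eq_mul, mul_add, ← mul_assoc, div_mul_cancel₀ κ hq'.ne']
    linarith

end TriangleBounds

section Unimodular

variable {d : ℕ} {e e' : (Fin d → ℝ) ≃ᵃ[ℝ] (Fin d → ℝ)}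

/-- Affine automorphisms of `ℝᵈ` that preserve the lattice `ℤᵈ`. -/
def IsUnimodular (e : (Fin d → ℝ) ≃ᵃ[ℝ] (Fin d → ℝ)) : Prop :=
  ∀ x, e x ∈ integerPoints d ↔ x ∈ integerPoints d

theorem IsUnimodular.trans (he : IsUnimodular e) (he' : IsUnimodular e') :
    IsUnimodular (e.trans e') :=
  fun x => (he' (e x)).trans (he x)

theorem IsUnimodular.isLatticeFunctional_coord (he : IsUnimodular e) (i : Fin d) :
    IsLatticeFunctional ((AffineMap.proj i).comp (e : (Fin d → ℝ) →ᵃ[ℝ] Fin d → ℝ)) :=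
  fun x hx => (he x).2 hx i

theorem IsUnimodular.image_inter_integerPoints (he : IsUnimodular e) (S : Set (Fin d → ℝ)) :
    e '' (S ∩ integerPoints d) = e '' S ∩ integerPoints d := by
  ext y
  constructor
  · rintro ⟨x, ⟨hxS, hx⟩, rfl⟩
    exact ⟨mem_image_of_mem e hxS, (he x).2 hx⟩
  · rintro ⟨⟨x, hxS, rfl⟩, hx⟩
    exact ⟨x, ⟨hxS, (he x).1 hx⟩, rfl⟩

theorem mulVec_add_mem_integerPoints (M : Matrix (Fin d) (Fin d) ℤ) {t x : Fin d → ℝ}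
    (ht : t ∈ integerPoints d) (hx : x ∈ integerPoints d) :
    M.map (fun n : ℤ => (n : ℝ)) *ᵥ x + t ∈ integerPoints d := by
  choose s hs using ht
  choose y hy using hx
  exact fun i => ⟨(M *ᵥ y) i + s i, by simp [Matrix.mulVec, dotProduct, hs, hy]⟩

theorem exists_isUnimodular (M : Matrix (Fin d) (Fin d) ℤ) (hM : IsUnit M.det) {t : Fin d → ℝ}
    (ht : t ∈ integerPoints d) :
    ∃ e, IsUnimodular e ∧ ∀ x, e x = M.map (fun n : ℤ => (n : ℝ)) *ᵥ x + t := by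
  have hmap : ∀ N N' : Matrix (Fin d) (Fin d) ℤ, N * N' = 1 →
      N.map (fun n : ℤ => (n : ℝ)) * N'.map (fun n : ℤ => (n : ℝ)) = 1 := fun N N' h => by
    simpa [h] using (Matrix.map_mul (f := Int.castRingHom ℝ) (L := N) (M := N')).symm
  have hinv := hmap _ _ (M.nonsing_inv_mul hM)
  have hinv' := hmap _ _ (M.mul_nonsing_inv hM)
  let e := (Matrix.toLin'OfInv hinv hinv').toAffineEquiv.trans (AffineEquiv.constVAdd ℝ _ t)
  have he : ∀ x, e x = M.map (fun n : ℤ => (n : ℝ)) *ᵥ x + t := fun x => by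
    simp [e, Matrix.toLin'OfInv, add_comm]
  refine ⟨e, fun x => ⟨fun hx => ?_, fun hx => he x ▸ mulVec_add_mem_integerPoints M ht hx⟩, he⟩
  have hxt : e x + -t ∈ integerPoints d := by
    simpa using mulVec_add_mem_integerPoints 1 (t := -t)
      (fun i => (ht i).imp' (- ·) fun n hn => by simp [hn]) hx
  simpa [he, Matrix.mulVec_mulVec, hinv] using
    mulVec_add_mem_integerPoints M⁻¹ (t := 0) (fun _ => ⟨0, by simp⟩) hxt

theorem vec_intCast_mem_integerPoints (m n : ℤ) : ![(m : ℝ), n] ∈ integerPoints 2 :=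
  Fin.forall_fin_two.2 ⟨⟨m, rfl⟩, ⟨n, rfl⟩⟩

theorem exists_isUnimodular_shear (m n : ℤ) :
    ∃ e : (Fin 2 → ℝ) ≃ᵃ[ℝ] (Fin 2 → ℝ), IsUnimodular e ∧
      ∀ x, e x = ![x 0 + m * x 1 + n, x 1] := by
  obtain ⟨e, he, heq⟩ := exists_isUnimodular !![1, m; 0, 1] (by simp)
    (vec_intCast_mem_integerPoints n 0)
  refine ⟨e, he, fun x => ?_⟩
  rw [heq]
  ext i
  fin_cases i <;> simp

theorem exists_isUnimodular_diagonal {σ τ : ℤ} (hσ : IsUnit σ) (hτ : IsUnit τ) (n : ℤ) :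
    ∃ e : (Fin 2 → ℝ) ≃ᵃ[ℝ] (Fin 2 → ℝ), IsUnimodular e ∧
      ∀ x, e x = ![σ * x 0 + n, τ * x 1] := by
  obtain ⟨e, he, heq⟩ := exists_isUnimodular !![σ, 0; 0, τ] (by simpa using ⟨hσ, hτ⟩)
    (vec_intCast_mem_integerPoints n 0)
  refine ⟨e, he, fun x => ?_⟩
  rw [heq]
  ext i
  fin_cases i <;> simp

theorem exists_isUnimodular_map_eq_zero {z z' : Fin 2 → ℝ} (hz : z ∈ integerPoints 2)
    (hz' : z' ∈ integerPoints 2) (hne : z ≠ z') :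
    ∃ e, IsUnimodular e ∧ e z = 0 ∧ 1 ≤ e z' 0 ∧ e z' 1 = 0 := by
  choose m hm using hz
  choose m' hm' using hz'
  have hgcd : 0 < Int.gcd (m' 0 - m 0) (m' 1 - m 1) := by
    rw [Int.gcd_pos_iff]
    contrapose! hne
    ext i
    fin_cases i <;> simp [hm, hm', sub_eq_zero.1 hne.1, sub_eq_zero.1 hne.2]
  obtain ⟨g, c₀, c₁, hg, hc, hc₀, hc₁⟩ := Int.exists_gcd_one' hgcd
  obtain ⟨s, r, hsr⟩ := Int.isCoprime_iff_gcd_eq_one.2 hc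
  obtain ⟨e, he, heq⟩ := exists_isUnimodular !![s, r; -c₁, c₀]
    (by rw [Matrix.det_fin_two_of]; exact Int.isUnit_iff.2 (by left; linarith))
    (vec_intCast_mem_integerPoints (-(s * m 0 + r * m 1)) (c₁ * m 0 - c₀ * m 1))
  have hc₀' : (m' 0 : ℝ) - m 0 = c₀ * g := mod_cast hc₀
  have hc₁' : (m' 1 : ℝ) - m 1 = c₁ * g := mod_cast hc₁
  have hsr' : (s : ℝ) * c₀ + r * c₁ = 1 := mod_cast hsr
  have he₀ : ∀ x, e x 0 = s * (x 0 - m 0) + r * (x 1 - m 1) := fun x => by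
    simp only [heq, Matrix.mulVec_fin_two, Matrix.map_apply, Matrix.of_apply, Matrix.cons_val',
      Matrix.cons_val_zero, Matrix.cons_val_one, Matrix.cons_val_fin_one, Pi.add_apply]
    push_cast
    ring
  have he₁ : ∀ x, e x 1 = c₀ * (x 1 - m 1) - c₁ * (x 0 - m 0) := fun x => by
    simp only [heq, Matrix.mulVec_fin_two, Matrix.map_apply, Matrix.of_apply, Matrix.cons_val',
      Matrix.cons_val_zero, Matrix.cons_val_one, Matrix.cons_val_fin_one, Pi.add_apply]
    push_cast
    ring
  have hg' : (1 : ℝ) ≤ g := mod_cast hg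
  refine ⟨e, he, ?_, ?_, ?_⟩
  · ext i
    fin_cases i <;> simp [he₀, he₁, hm]
  · rw [he₀, hm', hm']
    linear_combination hg' - s * hc₀' - r * hc₁' - g * hsr'
  · rw [he₁, hm', hm']
    linear_combination c₀ * hc₁' - c₁ * hc₀'

theorem exists_isUnimodular_horizontal {a b : Fin 2 → ℝ}
    (hab : (segment ℝ a b ∩ integerPoints 2).Nontrivial) :
    ∃ e, IsUnimodular e ∧ e a 1 = 0 ∧ e b 1 = 0 ∧ e a 0 ≤ 0 ∧ 1 ≤ e b 0 := by
  obtain ⟨t, t', ht, ht', hlt, hne, hz, hz'⟩ : ∃ t t' : ℝ, 0 ≤ t ∧ t' ≤ 1 ∧ t < t' ∧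
      lineMap a b t ≠ lineMap a b t' ∧
      lineMap a b t ∈ integerPoints 2 ∧ lineMap a b t' ∈ integerPoints 2 := by
    simp only [Set.Nontrivial, segment_eq_image_lineMap] at hab
    obtain ⟨_, ⟨⟨t, ht, rfl⟩, hz⟩, _, ⟨⟨t', ht', rfl⟩, hz'⟩, hne⟩ := hab
    rcases lt_or_gt_of_ne (ne_of_apply_ne _ hne) with hlt | hlt
    exacts [⟨t, t', ht.1, ht'.2, hlt, hne, hz, hz'⟩, ⟨t', t, ht'.1, ht.2, hlt, hne.symm, hz', hz⟩]
  obtain ⟨e, he, hzero, hone, hzero'⟩ := exists_isUnimodular_map_eq_zero hz hz' hne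
  have hcoord : ∀ s i, e (lineMap a b s) i = e a i + s * (e b i - e a i) := fun s i => by
    rw [← AffineEquiv.coe_toAffineMap, apply_lineMap, pi_lineMap_apply, lineMap_apply_ring']
    exact add_comm _ _
  have ht₀ := hcoord t 0
  have ht₁ := hcoord t 1
  rw [hzero, Pi.zero_apply] at ht₀ ht₁
  rw [hcoord] at hone hzero'
  have hvert : e b 1 - e a 1 = 0 := by
    refine (mul_eq_zero.1 ?_).resolve_left (sub_ne_zero.2 hlt.ne')
    linear_combination hzero' + ht₁
  have hhor : 0 < e b 0 - e a 0 := by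
    refine pos_of_mul_pos_right (a := t' - t) ?_ (sub_nonneg.2 hlt.le)
    linarith
  refine ⟨e, he, ?_, ?_, ?_, ?_⟩
  · linear_combination -ht₁ - t * hvert
  · linear_combination -ht₁ + (1 - t) * hvert
  · linarith [mul_nonneg ht hhor.le]
  · linarith [mul_nonneg (sub_nonneg.2 ht') hhor.le]

end Unimodular

section AffineFunctionals

variable {E : Type*} [AddCommGroup E] [Module ℝ E] {u : E →ᵃ[ℝ] ℝ} {w x y z : E}

theorem add_sum_smul_mem_of_convex {ι : Type*} [Fintype ι] {S : Set E} (hS : Convex ℝ S)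
    (hx : x ∈ S) {v : ι → E} (hv : ∀ j, x + v j ∈ S) {w : ι → ℝ} (hw : ∀ j, 0 ≤ w j)
    (hsum : ∑ j, w j ≤ 1) : x + ∑ j, w j • v j ∈ S := by
  have hmem := hS.sum_mem (t := Finset.univ) (w := fun o : Option ι => o.elim (1 - ∑ j, w j) w)
    (z := fun o => o.elim x (x + v ·)) (by rintro (_ | j) _ <;> simp [hsum, hw])
    (by simp [Fintype.sum_option]) (by rintro (_ | j) _ <;> simp [hx, hv])
  simpa [Fintype.sum_option, sub_smul, Finset.sum_add_distrib, ← Finset.sum_smul, ← add_assoc]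
    using hmem

theorem affineMap_apply_add_smul (u : E →ᵃ[ℝ] ℝ) (x y : E) (t : ℝ) :
    u (x + t • y) = u x + t * (u (x + y) - u x) := by
  have : x + t • y = lineMap x (x + y) t := by simp [lineMap_apply_module', add_comm]
  rw [this, apply_lineMap, lineMap_apply_ring', add_comm]

theorem affineMap_concaveOn_univ (u : E →ᵃ[ℝ] ℝ) : ConcaveOn ℝ univ u :=
  ⟨convex_univ, fun _ _ _ _ _ _ _ _ hst => (Convex.combo_affine_apply hst).ge⟩

/-- `u` vanishes on the line through `x` and `y` and is positive at `z`: for a triangle with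
vertices `x`, `y`, `z`, the inequality `0 ≤ u` is the facet defining one of the side `[x, y]`. -/
structure IsSideFunctional (u : E →ᵃ[ℝ] ℝ) (x y z : E) : Prop where
  left : u x = 0
  right : u y = 0
  opposite : 0 < u z

namespace IsSideFunctional

theorem symm (hu : IsSideFunctional u x y z) : IsSideFunctional u y x z :=
  ⟨hu.right, hu.left, hu.opposite⟩

theorem nonneg_of_mem_convexHull (hu : IsSideFunctional u x y z)
    (hw : w ∈ convexHull ℝ {z, x, y}) : 0 ≤ u w := by
  have hconvex : Convex ℝ {w | 0 ≤ u w} := (convex_Ici 0).affine_preimage u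
  refine convexHull_min ?_ hconvex hw
  rintro _ (rfl | rfl | rfl)
  exacts [hu.opposite.le, hu.left.ge, hu.right.ge]

theorem mem_segment_of_apply_eq_zero (hu : IsSideFunctional u x y z)
    (hw : w ∈ convexHull ℝ {z, x, y}) (hzero : u w = 0) : w ∈ segment ℝ x y := by
  rw [convexHull_insert (insert_nonempty _ _), convexHull_pair, mem_convexJoin] at hw
  obtain ⟨_, rfl, w', hw', s, t, hs, ht, hst, rfl⟩ := hw
  have huw' : u w' = 0 := by
    obtain ⟨s', t', -, -, hst', rfl⟩ := hw'
    simp [Convex.combo_affine_apply hst', hu.left, hu.right]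
  rw [Convex.combo_affine_apply hst, huw', smul_zero, add_zero, smul_eq_mul,
    mul_eq_zero_iff_right hu.opposite.ne'] at hzero
  obtain rfl : t = 1 := by linarith
  simpa [hzero] using hw'

end IsSideFunctional

end AffineFunctionals

section T2ATriangles

variable {v a b z : Fin 2 → ℝ}

/-- `v` is an admissible choice of the non-integral vertex of a triangle of type `T^{2A}`, and
`a`, `b` are the ends of the opposite side. -/
structure IsT2AWithVertices (v a b : Fin 2 → ℝ) : Prop where
  isLatticeFree : IsLatticeFree (convexHull ℝ {v, a, b})
  affineIndependent : AffineIndependent ℝ ![v, a, b]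
  apex_notMem : v ∉ integerPoints 2
  base_nontrivial : (segment ℝ a b ∩ integerPoints 2).Nontrivial
  left_existsUnique : ∃! z, z ∈ openSegment ℝ v a ∩ integerPoints 2
  right_existsUnique : ∃! z, z ∈ openSegment ℝ v b ∩ integerPoints 2

theorem IsTriangleT2A.exists_isT2AWithVertices {T : Set (Fin 2 → ℝ)} (hT : IsTriangleT2A T) :
    ∃ v a b, T = convexHull ℝ {v, a, b} ∧ IsT2AWithVertices v a b := by
  obtain ⟨hfree, v, a, b, hind, rfl, hv, hbase, hleft, hright⟩ := hT
  exact ⟨v, a, b, rfl, hfree, hind, hv, hbase, hleft, hright⟩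

namespace IsT2AWithVertices

theorem swap (h : IsT2AWithVertices v a b) : IsT2AWithVertices v b a where
  isLatticeFree := by rw [Set.pair_comm]; exact h.isLatticeFree
  affineIndependent := by
    rw [affineIndependent_iff_not_collinear_set, Set.pair_comm,
      ← affineIndependent_iff_not_collinear_set]
    exact h.affineIndependent
  apex_notMem := h.apex_notMem
  base_nontrivial := by rw [segment_symm]; exact h.base_nontrivial
  left_existsUnique := h.right_existsUnique
  right_existsUnique := h.left_existsUnique

theorem map (h : IsT2AWithVertices v a b) {e : (Fin 2 → ℝ) ≃ᵃ[ℝ] (Fin 2 → ℝ)}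
    (he : IsUnimodular e) : IsT2AWithVertices (e v) (e a) (e b) := by
  have hunique : ∀ c, (∃! z, z ∈ openSegment ℝ v c ∩ integerPoints 2) →
      ∃! z, z ∈ openSegment ℝ (e v) (e c) ∩ integerPoints 2 := by
    rintro c ⟨z, hz, huniq⟩
    have himage := image_openSegment ℝ (e : (Fin 2 → ℝ) →ᵃ[ℝ] Fin 2 → ℝ) v c
    simp only [AffineEquiv.coe_toAffineMap] at himage
    rw [← himage, ← he.image_inter_integerPoints]
    refine ⟨e z, mem_image_of_mem e hz, ?_⟩
    rintro _ ⟨z', hz', rfl⟩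
    rw [huniq z' hz']
  refine ⟨?_, ?_, (he v).not.2 h.apex_notMem, ?_, hunique a h.left_existsUnique,
    hunique b h.right_existsUnique⟩
  · have hhull : convexHull ℝ {e v, e a, e b} = e '' convexHull ℝ {v, a, b} := by
      have := AffineMap.image_convexHull (e : (Fin 2 → ℝ) →ᵃ[ℝ] Fin 2 → ℝ) {v, a, b}
      simpa [image_insert_eq] using this.symm
    have hinterior : e '' interior (convexHull ℝ {v, a, b}) =
        interior (e '' convexHull ℝ {v, a, b}) :=
      e.toContinuousAffineEquiv.toHomeomorph.image_interior _
    rw [IsLatticeFree, hhull, ← hinterior, ← he.image_inter_integerPoints, h.isLatticeFree,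
      image_empty]
  · have := (e.affineIndependent_iff (p := ![v, a, b])).2 h.affineIndependent
    convert this using 1
    ext i
    fin_cases i <;> rfl
  · have himage := image_segment ℝ (e : (Fin 2 → ℝ) →ᵃ[ℝ] Fin 2 → ℝ) a b
    simp only [AffineEquiv.coe_toAffineMap] at himage
    rw [← himage, ← he.image_inter_integerPoints]
    exact h.base_nontrivial.image e.injective

end IsT2AWithVertices

/-- A triangle of type `T^{2A}` whose base `[a, b]` lies on the first coordinate axis below the
apex `v` and contains the points `(0, 0)` and `(1, 0)`. -/
structure IsBasedT2A (v a b : Fin 2 → ℝ) : Prop extends IsT2AWithVertices v a b where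
  left_one : a 1 = 0
  right_one : b 1 = 0
  apex_pos : 0 < v 1
  left_nonpos : a 0 ≤ 0
  one_le_right : 1 ≤ b 0

theorem IsT2AWithVertices.exists_isUnimodular_isBasedT2A (h : IsT2AWithVertices v a b) :
    ∃ e, IsUnimodular e ∧ IsBasedT2A (e v) (e a) (e b) := by
  obtain ⟨e, he, ha, hb, ha', hb'⟩ := exists_isUnimodular_horizontal h.base_nontrivial
  have hv : e v 1 ≠ 0 := fun hv => by
    refine affineIndependent_iff_not_collinear_set.1 (h.map he).affineIndependent ?_
    refine collinear_iff_exists_forall_eq_smul_vadd _ |>.2 ⟨0, ![1, 0], ?_⟩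
    have haxis : ∀ x : Fin 2 → ℝ, x 1 = 0 → ∃ t : ℝ, x = t • ![(1 : ℝ), 0] +ᵥ (0 : Fin 2 → ℝ) :=
      fun x hx => ⟨x 0, by ext i; fin_cases i <;> simp [hx]⟩
    rintro _ (rfl | rfl | rfl)
    exacts [haxis _ hv, haxis _ ha, haxis _ hb]
  rcases lt_or_gt_of_ne hv with hneg | hpos
  · obtain ⟨e', he', heq⟩ := exists_isUnimodular_diagonal isUnit_one isUnit_one.neg 0
    refine ⟨e.trans e', he.trans he', h.map (he.trans he'), ?_, ?_, ?_, ?_, ?_⟩ <;>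
      simp [*]
  · exact ⟨e, he, h.map he, ha, hb, hpos, ha', hb'⟩

/-- First coordinate of the point at height `y` on the line through the apex `v` and the vertex
`a`, which is assumed to have height `0`. -/
noncomputable def sideAbscissa (v a : Fin 2 → ℝ) (y : ℝ) : ℝ :=
  a 0 + y / v 1 * (v 0 - a 0)

theorem mem_openSegment_iff_eq_sideAbscissa (ha : a 1 = 0) (hv : 0 < v 1) :
    z ∈ openSegment ℝ v a ↔ z 1 ∈ Ioo 0 (v 1) ∧ z 0 = sideAbscissa v a (z 1) := by
  rw [openSegment_symm, openSegment_eq_image_lineMap]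
  constructor
  · rintro ⟨t, ht, rfl⟩
    have h₁ : (lineMap a v t : Fin 2 → ℝ) 1 = t * v 1 := by
      simp [pi_lineMap_apply, lineMap_apply_ring', ha]
    rw [h₁]
    refine ⟨⟨mul_pos ht.1 hv, mul_lt_of_lt_one_left hv ht.2⟩, ?_⟩
    rw [sideAbscissa, mul_div_cancel_right₀ t hv.ne', pi_lineMap_apply, lineMap_apply_ring',
      add_comm]
  · rintro ⟨hz, hz₀⟩
    refine ⟨z 1 / v 1, ⟨div_pos hz.1 hv, (div_lt_one hv).2 hz.2⟩, ?_⟩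
    ext i
    fin_cases i
    · simp [pi_lineMap_apply, lineMap_apply_ring', hz₀, sideAbscissa, add_comm]
    · simp [pi_lineMap_apply, lineMap_apply_ring', ha, div_mul_cancel₀ _ hv.ne']

theorem mem_interior_convexHull_of_sideAbscissa_lt (ha : a 1 = 0) (hb : b 1 = 0)
    (hz : z 1 ∈ Ioo 0 (v 1)) (hleft : sideAbscissa v a (z 1) < z 0)
    (hright : z 0 < sideAbscissa v b (z 1)) : z ∈ interior (convexHull ℝ {v, a, b}) := by
  have hcont : ∀ c : Fin 2 → ℝ, Continuous fun x : Fin 2 → ℝ => sideAbscissa v c (x 1) :=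
    fun c => by unfold sideAbscissa; fun_prop
  have hopen : IsOpen {x : Fin 2 → ℝ | x 1 ∈ Ioo 0 (v 1) ∧
      sideAbscissa v a (x 1) < x 0 ∧ x 0 < sideAbscissa v b (x 1)} :=
    (isOpen_Ioo.preimage (continuous_apply 1)).inter
      ((isOpen_lt (hcont a) (continuous_apply 0)).inter
        (isOpen_lt (continuous_apply 0) (hcont b)))
  refine interior_maximal ?_ hopen ⟨hz, hleft, hright⟩
  rintro x ⟨hx, hxa, hxb⟩
  have hside : ∀ c ∈ ({v, a, b} : Set (Fin 2 → ℝ)), c 1 = 0 →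
      ![sideAbscissa v c (x 1), x 1] ∈ convexHull ℝ {v, a, b} := fun c hc hc₁ =>
    (convex_convexHull ℝ _).openSegment_subset (subset_convexHull ℝ _ (by simp))
      (subset_convexHull ℝ _ hc)
      ((mem_openSegment_iff_eq_sideAbscissa hc₁ (hx.1.trans hx.2)).2 ⟨hx, rfl⟩)
  refine (convex_convexHull ℝ _).segment_subset (hside a (by simp) ha) (hside b (by simp) hb) ?_
  obtain ⟨s, t, hs, ht, hst, hxst⟩ : x 0 ∈ segment ℝ (sideAbscissa v a (x 1))
      (sideAbscissa v b (x 1)) := by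
    rw [segment_eq_Icc (hxa.trans hxb).le]
    exact ⟨hxa.le, hxb.le⟩
  refine ⟨s, t, hs, ht, hst, ?_⟩
  ext i
  fin_cases i
  · simpa using hxst
  · simp [← add_mul, hst]

namespace IsBasedT2A

theorem one_lt_apex (h : IsBasedT2A v a b) : 1 < v 1 := by
  obtain ⟨z, ⟨hzside, hz⟩, -⟩ := h.left_existsUnique
  obtain ⟨hheight, -⟩ := (mem_openSegment_iff_eq_sideAbscissa h.left_one h.apex_pos).1 hzside
  obtain ⟨n, hn⟩ := hz 1
  rw [hn] at hheight
  have hn_pos : 1 ≤ n := mod_cast hheight.1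
  exact (Int.cast_one_le_of_pos hn_pos).trans_lt hheight.2

theorem sideAbscissa_lt (h : IsBasedT2A v a b) {y : ℝ} (hy : y < v 1) :
    sideAbscissa v a y < sideAbscissa v b y := by
  have hbase : a 0 < b 0 := by linarith [h.left_nonpos, h.one_le_right]
  have hpos : 0 < 1 - y / v 1 := sub_pos.2 ((div_lt_one h.apex_pos).2 hy)
  unfold sideAbscissa
  linarith [mul_pos (sub_pos.2 hbase) hpos]

theorem notMem_integerPoints (h : IsBasedT2A v a b) (hz : z 1 ∈ Ioo 0 (v 1))
    (hleft : sideAbscissa v a (z 1) < z 0) (hright : z 0 < sideAbscissa v b (z 1)) :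
    z ∉ integerPoints 2 := fun hint =>
  eq_empty_iff_forall_notMem.1 h.isLatticeFree z
    ⟨mem_interior_convexHull_of_sideAbscissa_lt h.left_one h.right_one hz hleft hright, hint⟩

theorem reflect (h : IsBasedT2A v a b) :
    IsBasedT2A ![1 - v 0, v 1] ![1 - b 0, b 1] ![1 - a 0, a 1] := by
  obtain ⟨e, he, heq⟩ := exists_isUnimodular_diagonal isUnit_one.neg isUnit_one 1
  have heq' : ∀ x, ![1 - x 0, x 1] = e x := fun x => by
    rw [heq]; ext i; fin_cases i <;> simp [neg_add_eq_sub]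
  refine ⟨?_, h.right_one, h.left_one, h.apex_pos, ?_, ?_⟩
  · simpa only [heq'] using (h.map he).swap
  · simpa using h.one_le_right
  · simpa using h.left_nonpos

theorem exists_isUnimodular_sideAbscissa_bounds (h : IsBasedT2A v a b) :
    ∃ e, IsUnimodular e ∧ IsBasedT2A (e v) (e a) (e b) ∧
      0 ≤ sideAbscissa (e v) (e a) 1 ∧ sideAbscissa (e v) (e b) 1 ≤ 1 := by
  obtain ⟨e, he, heq⟩ := exists_isUnimodular_shear (-⌊sideAbscissa v a 1⌋) 0
  have hone := h.one_lt_apex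
  have habscissa : ∀ c, c 1 = 0 →
      sideAbscissa (e v) (e c) 1 = sideAbscissa v c 1 - ⌊sideAbscissa v a 1⌋ := fun c hc => by
    simp only [sideAbscissa, heq, hc, Matrix.cons_val_zero, Matrix.cons_val_one,
      Matrix.cons_val_fin_one]
    push_cast
    field_simp
    ring
  refine ⟨e, he, ⟨h.map he, ?_, ?_, ?_, ?_, ?_⟩, ?_, ?_⟩
  · simp [heq, h.left_one]
  · simp [heq, h.right_one]
  · simp [heq, h.apex_pos]
  · simp [heq, h.left_one, h.left_nonpos]
  · simp [heq, h.right_one, h.one_le_right]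
  · rw [habscissa a h.left_one]
    exact Int.fract_nonneg _
  · rw [habscissa b h.right_one]
    by_contra! hlt
    refine h.notMem_integerPoints (z := ![(⌊sideAbscissa v a 1⌋ + 1 : ℤ), (1 : ℤ)]) ?_ ?_ ?_
      (vec_intCast_mem_integerPoints _ _)
    · simpa using hone
    · simp
    · simpa using by linarith

theorem sideAbscissa_left_eq_zero (h : IsBasedT2A v a b) (hleft : 0 ≤ sideAbscissa v a 1)
    (hright : sideAbscissa v b 1 ≤ 1) : sideAbscissa v a 1 = 0 := by
  obtain ⟨z, ⟨hzside, hz⟩, -⟩ := h.left_existsUnique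
  obtain ⟨hheight, hz₀⟩ := (mem_openSegment_iff_eq_sideAbscissa h.left_one h.apex_pos).1 hzside
  have hlt := h.sideAbscissa_lt hheight.2
  obtain ⟨m, hm⟩ := hz 0
  obtain ⟨n, hn⟩ := hz 1
  rw [hn] at hheight hz₀ hlt
  rw [hm] at hz₀
  have hn_one : (1 : ℝ) ≤ n := by
    have : (0 : ℤ) < n := mod_cast hheight.1
    exact_mod_cast this
  -- The sides move outwards between height `1` and the base, hence inwards above height `1`.
  have hline : ∀ c, sideAbscissa v c n =
      sideAbscissa v c 1 + (sideAbscissa v c 1 - c 0) * (n - 1) := fun c => by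
    unfold sideAbscissa; ring
  have hsummand : 0 ≤ (sideAbscissa v a 1 - a 0) * (n - 1) :=
    mul_nonneg (by linarith [h.left_nonpos]) (by linarith)
  have hright' : sideAbscissa v b n ≤ 1 := by
    rw [hline]
    linarith [mul_nonneg (a := b 0 - sideAbscissa v b 1) (by linarith [h.one_le_right])
      (sub_nonneg.2 hn_one)]
  have hm_zero : m = 0 := by
    have hm_nonneg : (0 : ℝ) ≤ m := by rw [hz₀, hline]; positivity
    have hm_lt : (m : ℝ) < 1 := by linarith
    have : 0 ≤ m := mod_cast hm_nonneg
    have : m < 1 := mod_cast hm_lt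
    omega
  rw [hm_zero, Int.cast_zero, hline] at hz₀
  linarith

theorem sideAbscissa_right_eq_one (h : IsBasedT2A v a b) (hleft : 0 ≤ sideAbscissa v a 1)
    (hright : sideAbscissa v b 1 ≤ 1) : sideAbscissa v b 1 = 1 := by
  have hreflect : ∀ c : Fin 2 → ℝ,
      sideAbscissa ![1 - v 0, v 1] ![1 - c 0, c 1] 1 = 1 - sideAbscissa v c 1 := fun c => by
    simp only [sideAbscissa, Matrix.cons_val_zero, Matrix.cons_val_one, Matrix.cons_val_fin_one]
    ring
  have := h.reflect.sideAbscissa_left_eq_zero (by rw [hreflect]; linarith)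
    (by rw [hreflect]; linarith)
  rw [hreflect] at this
  linarith

end IsBasedT2A

theorem IsT2AWithVertices.apex_lt_two_of_vertical (h : IsT2AWithVertices v a b) (ha : a 1 = 0)
    {n : ℤ} (ha₀ : a 0 = n) (hv₀ : v 0 = n) : v 1 < 2 := by
  by_contra! hv
  have hmem : ∀ m : ℤ, (m : ℝ) ∈ Ioo 0 (v 1) →
      ![(n : ℝ), m] ∈ openSegment ℝ v a ∩ integerPoints 2 := fun m hm =>
    ⟨(mem_openSegment_iff_eq_sideAbscissa ha (by linarith)).2
      ⟨hm, by simp [sideAbscissa, ha₀, hv₀]⟩, vec_intCast_mem_integerPoints n m⟩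
  rcases hv.eq_or_lt with htwo | hlt
  · refine h.apex_notMem ?_
    convert vec_intCast_mem_integerPoints n 2 using 1
    ext i
    fin_cases i <;> simp [hv₀, ← htwo]
  · have := h.left_existsUnique.unique (hmem 1 ⟨by simp, by push_cast; linarith⟩)
      (hmem 2 ⟨by simp, by simpa using hlt⟩)
    simpa using congrFun this 1

theorem IsBasedT2A.exists_int_between (h : IsBasedT2A v a b) (hleft : sideAbscissa v a 1 = 0)
    (hright : sideAbscissa v b 1 = 1) : ∃ n : ℤ, a 0 < n ∧ n + 1 < b 0 := by
  have hv := h.apex_pos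
  unfold sideAbscissa at hleft hright
  have hwidth : (b 0 - a 0 - 1) * (v 1 - 1) = 1 := by
    field_simp at hleft hright
    linear_combination hright - hleft
  have hwide : v 1 < 2 → 2 < b 0 - a 0 := fun hlt => by
    by_contra! hle
    have := mul_le_mul_of_nonneg_right hle (sub_nonneg.2 h.one_lt_apex.le)
    linarith
  rcases h.left_nonpos.lt_or_eq with ha₀ | ha₀
  · rcases h.one_le_right.lt_or_eq with hb₀ | hb₀
    · exact ⟨0, by simpa using ha₀, by simpa using hb₀⟩
    · have hv₀ : v 0 = (1 : ℤ) := by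
        rw [← hb₀] at hright
        field_simp at hright
        push_cast
        linarith
      have := hwide (h.swap.apex_lt_two_of_vertical h.right_one (by simp [← hb₀]) hv₀)
      refine ⟨-1, ?_, ?_⟩ <;> push_cast <;> linarith
  · have hv₀ : v 0 = (0 : ℤ) := by
      rw [ha₀] at hleft
      field_simp at hleft
      push_cast
      linarith
    have := hwide (h.apex_lt_two_of_vertical h.left_one (by simp [ha₀]) hv₀)
    refine ⟨1, ?_, ?_⟩ <;> push_cast <;> linarith

theorem IsT2AWithVertices.exists_isUnimodular_normalForm (h : IsT2AWithVertices v a b) :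
    ∃ e, IsUnimodular e ∧ ∃ p q : ℝ, 0 < p ∧ 0 < q ∧ e a = ![-p, 0] ∧ e b = ![1 + q, 0] ∧
      0 < e v 1 ∧ e v 0 = p * (e v 1 - 1) ∧ 1 - e v 0 = q * (e v 1 - 1) := by
  obtain ⟨e₁, he₁, h₁⟩ := h.exists_isUnimodular_isBasedT2A
  obtain ⟨e₂, he₂, h₂, hleft, hright⟩ := h₁.exists_isUnimodular_sideAbscissa_bounds
  have hleft' := h₂.sideAbscissa_left_eq_zero hleft hright
  have hright' := h₂.sideAbscissa_right_eq_one hleft hright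
  obtain ⟨n, hna, hnb⟩ := h₂.exists_int_between hleft' hright'
  obtain ⟨e₃, he₃, heq⟩ := exists_isUnimodular_shear n (-n)
  have hv := h₂.apex_pos
  unfold sideAbscissa at hleft' hright'
  field_simp at hleft' hright'
  refine ⟨(e₁.trans e₂).trans e₃, (he₁.trans he₂).trans he₃, n - e₂ (e₁ a) 0,
    e₂ (e₁ b) 0 - (n + 1), sub_pos.2 hna, sub_pos.2 hnb, ?_, ?_, ?_, ?_, ?_⟩
  · simp [heq, h₂.left_one, sub_eq_add_neg]
  · simp only [AffineEquiv.coe_trans, Function.comp_apply, heq, h₂.right_one]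
    congr 1
    push_cast
    ring
  · simpa [heq] using hv
  · simp only [AffineEquiv.coe_trans, Function.comp_apply, heq, Matrix.cons_val_zero,
      Matrix.cons_val_one, Matrix.cons_val_fin_one]
    push_cast
    linear_combination hleft'
  · simp only [AffineEquiv.coe_trans, Function.comp_apply, heq, Matrix.cons_val_zero,
      Matrix.cons_val_one, Matrix.cons_val_fin_one]
    push_cast
    linear_combination -hright'

theorem IsT2AWithVertices.exists_isLatticeFunctional (h : IsT2AWithVertices v a b) :
    ∃ X Y : (Fin 2 → ℝ) →ᵃ[ℝ] ℝ, IsLatticeFunctional X ∧ IsLatticeFunctional Y ∧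
      ∃ p q : ℝ, 0 < p ∧ 0 < q ∧ IsSideFunctional Y a b v ∧
        IsSideFunctional (leftSide X Y p) v a b ∧ IsSideFunctional (rightSide X Y q) v b a ∧
        (openSegment ℝ a b ∩ integerPoints 2).Nonempty := by
  obtain ⟨e, he, p, q, hp, hq, ha, hb, hv, hvp, hvq⟩ := h.exists_isUnimodular_normalForm
  have hzero : (0 : Fin 2 → ℝ) ∈ openSegment ℝ (e a) (e b) := by
    refine ⟨(1 + q) / (1 + q + p), p / (1 + q + p), by positivity, by positivity, by field_simp, ?_⟩
    ext i
    fin_cases i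
    · simp only [ha, hb, Fin.zero_eta, Pi.add_apply, Pi.smul_apply, Matrix.cons_val_zero,
        smul_eq_mul, Pi.zero_apply]
      field_simp
      ring
    · simp [ha, hb]
  have himage := image_openSegment ℝ (e : (Fin 2 → ℝ) →ᵃ[ℝ] Fin 2 → ℝ) a b
  simp only [AffineEquiv.coe_toAffineMap] at himage
  rw [← himage] at hzero
  obtain ⟨z, hz, hez⟩ := hzero
  refine ⟨_, _, he.isLatticeFunctional_coord 0, he.isLatticeFunctional_coord 1, p, q, hp, hq,
    ⟨?_, ?_, ?_⟩, ⟨?_, ?_, ?_⟩, ⟨?_, ?_, ?_⟩, z, hz, (he z).1 (hez ▸ fun _ => ⟨0, by simp⟩)⟩ <;>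
    simp only [coe_comp, Function.comp_apply, AffineEquiv.coe_toAffineMap, AffineMap.proj_apply,
      leftSide_apply, rightSide_apply, ha, hb, Matrix.cons_val_zero, Matrix.cons_val_one,
      Matrix.cons_val_fin_one] <;>
    linarith

end T2ATriangles

section InducedSet

variable {k : ℕ} {R : Matrix (Fin 2) (Fin k) ℚ} {f : Fin 2 → ℚ} {α : Fin k → ℝ}
  {u X Y : (Fin 2 → ℝ) →ᵃ[ℝ] ℝ} {x y z : Fin 2 → ℝ}

theorem mem_relaxation_iff {z : (Fin 2 → ℝ) × (Fin k → ℝ)} :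
    z ∈ relaxation R f ↔ realPoint f + ∑ j, z.2 j • column R j = z.1 ∧ 0 ≤ z.2 := by
  simp [relaxation, realPoint, column, funext_iff, Pi.le_def, mul_comm]

theorem lineMap_smul_mem_relaxation {z : (Fin 2 → ℝ) × (Fin k → ℝ)} (hz : z ∈ relaxation R f)
    {t : ℝ} (ht : 0 ≤ t) : (lineMap (realPoint f) z.1 t, t • z.2) ∈ relaxation R f := by
  obtain ⟨hz₁, hz₂⟩ := mem_relaxation_iff.1 hz
  refine mem_relaxation_iff.2 ⟨?_, smul_nonneg ht hz₂⟩
  simp [← hz₁, lineMap_apply_module', Finset.smul_sum, smul_smul, add_comm]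

theorem add_sum_smul_mem_relaxation {z : (Fin 2 → ℝ) × (Fin k → ℝ)} (hz : z ∈ relaxation R f)
    {c : Fin k → ℝ} (hc : 0 ≤ c) :
    (z.1 + ∑ j, c j • column R j, z.2 + c) ∈ relaxation R f := by
  obtain ⟨hz₁, hz₂⟩ := mem_relaxation_iff.1 hz
  refine mem_relaxation_iff.2 ⟨?_, add_nonneg hz₂ hc⟩
  simp [← hz₁, add_smul, Finset.sum_add_distrib, add_assoc]

theorem convex_relaxation : Convex ℝ (relaxation R f) := by
  intro z hz z' hz' s t hs ht hst
  obtain ⟨hz₁, hz₂⟩ := mem_relaxation_iff.1 hz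
  obtain ⟨hz₁', hz₂'⟩ := mem_relaxation_iff.1 hz'
  refine mem_relaxation_iff.2 ⟨?_, add_nonneg (smul_nonneg hs hz₂) (smul_nonneg ht hz₂')⟩
  simp only [← hz₁, ← hz₁', Prod.fst_add, Prod.snd_add, Prod.smul_fst, Prod.smul_snd,
    Pi.add_apply, Pi.smul_apply, smul_eq_mul, add_smul, mul_smul, smul_add,
    Finset.sum_add_distrib, ← Finset.smul_sum]
  rw [add_add_add_comm, ← add_smul, hst, one_smul]

theorem inducedSet_subset_image_relaxation :
    inducedSet R f α ⊆ Prod.fst '' (relaxation R f ∩ {z | α ⬝ᵥ z.2 ≤ 1}) := by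
  have hconvex : Convex ℝ (Prod.fst '' (relaxation R f ∩ {z | α ⬝ᵥ z.2 ≤ 1})) :=
    (convex_relaxation.inter (convex_halfSpace_le (f := fun z => α ⬝ᵥ z.2)
      ⟨fun _ _ => dotProduct_add _ _ _, fun _ _ => dotProduct_smul _ _ _⟩ 1)).linear_image
      (LinearMap.fst ℝ _ _)
  have hapex : (realPoint f, (0 : Fin k → ℝ)) ∈ relaxation R f :=
    mem_relaxation_iff.2 (by simp)
  rintro _ ⟨y, hy, _, ⟨c, hc, hcα, rfl⟩, rfl⟩
  obtain ⟨⟨y, s⟩, ⟨hs, hsα⟩, rfl⟩ : y ∈ Prod.fst '' (relaxation R f ∩ {z | α ⬝ᵥ z.2 ≤ 1}) := by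
    refine convexHull_min ?_ hconvex hy
    rintro _ (⟨j, hj, rfl⟩ | rfl)
    · refine ⟨(_, Pi.single j (α j)⁻¹), ⟨mem_relaxation_iff.2 ⟨?_, ?_⟩, ?_⟩, rfl⟩
      · simp [Pi.single_apply]
      · simpa using hj.le
      · simp [hj.ne']
    · exact ⟨_, ⟨hapex, by simp⟩, rfl⟩
  refine ⟨_, ⟨add_sum_smul_mem_relaxation hs hc, ?_⟩, rfl⟩
  have hcost : α ⬝ᵥ c = 0 := Finset.sum_eq_zero fun j _ => by
    by_cases hj : α j = 0
    · simp [hj]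
    · simp [hcα j hj]
  simpa [dotProduct_add, hcost] using hsα

theorem fst_mem_inducedSet (hα : ∀ j, 0 ≤ α j) {z : (Fin 2 → ℝ) × (Fin k → ℝ)}
    (hz : z ∈ relaxation R f) (hcost : α ⬝ᵥ z.2 ≤ 1) : z.1 ∈ inducedSet R f α := by
  obtain ⟨hz₁, hz₂⟩ := mem_relaxation_iff.1 hz
  -- Since `0⁻¹ = 0`, the points `f + (α j)⁻¹ rʲ` lie in the hull even when `α j = 0`.
  have hhull : realPoint f + ∑ j, (α j * z.2 j) • (α j)⁻¹ • column R j ∈ convexHull ℝ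
      ({y | ∃ j, 0 < α j ∧ y = realPoint f + (α j)⁻¹ • column R j} ∪ {realPoint f}) := by
    have hapex := subset_convexHull ℝ
      ({y | ∃ j, 0 < α j ∧ y = realPoint f + (α j)⁻¹ • column R j} ∪ {realPoint f}) (.inr rfl)
    refine add_sum_smul_mem_of_convex (convex_convexHull ℝ _) hapex (fun j => ?_)
      (fun j => mul_nonneg (hα j) (hz₂ j)) hcost
    rcases (hα j).eq_or_lt with hj | hj
    · simpa [← hj] using hapex
    · exact subset_convexHull ℝ _ (.inl ⟨j, hj, rfl⟩)
  refine ⟨_, hhull, ∑ j, (if α j = 0 then z.2 j else 0) • column R j,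
    ⟨_, fun j => ?_, fun j hj => if_neg hj, rfl⟩, ?_⟩
  · split_ifs
    exacts [hz₂ j, le_rfl]
  · beta_reduce
    rw [← hz₁, add_assoc, ← Finset.sum_add_distrib]
    refine congrArg (realPoint f + ·) (Finset.sum_congr rfl fun j _ => ?_)
    by_cases hj : α j = 0
    · simp [hj]
    · simp [hj, smul_smul, mul_right_comm]

theorem const_sub_mem_finiteRankBounds_of_nonneg (hα : ∀ j, 0 ≤ α j)
    (hu : ∀ y ∈ inducedSet R f α, 0 ≤ u y) (huf : 0 < u (realPoint f)) :
    const ℝ _ 1 - (u (realPoint f))⁻¹ • u ∈ finiteRankBounds (relaxation R f) α := by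
  refine ⟨0, fun z hz => le_of_forall_gt_imp_ge_of_dense fun σ hσ => ?_⟩
  have hcost : 0 ≤ α ⬝ᵥ z.2 := dotProduct_nonneg_of_nonneg hα (mem_relaxation_iff.1 hz).2
  have hσ_pos : 0 < σ := hcost.trans_lt hσ
  have hmem := fst_mem_inducedSet hα (lineMap_smul_mem_relaxation hz (inv_nonneg.2 hσ_pos.le)) (by
    rw [dotProduct_smul, smul_eq_mul, inv_mul_le_one₀ hσ_pos]
    exact hσ.le)
  have hnonneg := hu _ hmem
  rw [apply_lineMap, lineMap_apply_ring', inv_mul_eq_div, ← sub_le_iff_le_add,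
    le_div_iff₀ hσ_pos] at hnonneg
  simp only [coe_sub, coe_smul, Pi.sub_apply, Pi.smul_apply, const_apply, smul_eq_mul]
  rw [inv_mul_eq_div, sub_le_comm, le_div_iff₀ huf]
  linarith

theorem lineMap_notMem_integerPoints
    (hvalid : ∀ z ∈ mixedIntegerSet R f, 1 ≤ α ⬝ᵥ z.2) (hy : y ∈ inducedSet R f α) {t : ℝ}
    (ht : 0 ≤ t) (ht' : t < 1) : lineMap (realPoint f) y t ∉ integerPoints 2 := by
  intro hint
  obtain ⟨z, ⟨hz, hcost⟩, rfl⟩ := inducedSet_subset_image_relaxation hy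
  have := hvalid _ ⟨lineMap_smul_mem_relaxation hz ht, hint⟩
  rw [dotProduct_smul, smul_eq_mul] at this
  exact (mul_le_of_le_one_right ht hcost).not_gt (ht'.trans_le this)

theorem realPoint_notMem_segment
    (hvalid : ∀ z ∈ mixedIntegerSet R f, 1 ≤ α ⬝ᵥ z.2) (hx : x ∈ inducedSet R f α)
    (hy : y ∈ inducedSet R f α) (hxy : (openSegment ℝ x y ∩ integerPoints 2).Nonempty) :
    realPoint f ∉ segment ℝ x y := by
  obtain ⟨z, hz, hint⟩ := hxy
  intro hf
  have hopen : ∀ w ∈ inducedSet R f α, z ∉ openSegment ℝ (realPoint f) w := fun w hw hzw => by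
    rw [openSegment_eq_image_lineMap] at hzw
    obtain ⟨t, ht, rfl⟩ := hzw
    exact lineMap_notMem_integerPoints hvalid hw ht.1.le ht.2 hint
  have hline : realPoint f ∈ range (lineMap x y : ℝ → Fin 2 → ℝ) := by
    rw [segment_eq_image_lineMap] at hf
    exact image_subset_range _ _ hf
  rcases openSegment_subset_union x y hline hz with rfl | hz | hz
  · exact lineMap_notMem_integerPoints hvalid hx le_rfl one_pos (by simpa using hint)
  · exact hopen x hx (openSegment_symm ℝ x _ ▸ hz)
  · exact hopen y hy hz

theorem realPoint_mem_inducedSet (hα : ∀ j, 0 ≤ α j) : realPoint f ∈ inducedSet R f α :=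
  fst_mem_inducedSet hα (z := (realPoint f, 0)) (mem_relaxation_iff.2 (by simp)) (by simp)

theorem IsSideFunctional.const_sub_mem_finiteRankBounds (hu : IsSideFunctional u x y z)
    (hα : ∀ j, 0 ≤ α j) (hvalid : ∀ z ∈ mixedIntegerSet R f, 1 ≤ α ⬝ᵥ z.2)
    (hT : inducedSet R f α = convexHull ℝ {z, x, y})
    (hxy : (openSegment ℝ x y ∩ integerPoints 2).Nonempty) :
    0 < u (realPoint f) ∧
      const ℝ _ 1 - (u (realPoint f))⁻¹ • u ∈ finiteRankBounds (relaxation R f) α := by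
  have hnonneg : ∀ w ∈ inducedSet R f α, 0 ≤ u w := fun w hw =>
    hu.nonneg_of_mem_convexHull (hT ▸ hw)
  have hmem : ∀ w ∈ ({z, x, y} : Set (Fin 2 → ℝ)), w ∈ inducedSet R f α := fun w hw =>
    hT ▸ subset_convexHull ℝ _ hw
  have hf := realPoint_mem_inducedSet (R := R) (f := f) hα
  have hpos : 0 < u (realPoint f) := (hnonneg _ hf).lt_of_ne' fun hzero =>
    realPoint_notMem_segment hvalid (hmem x (by simp)) (hmem y (by simp)) hxy
      (hu.mem_segment_of_apply_eq_zero (hT ▸ hf) hzero)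
  exact ⟨hpos, const_sub_mem_finiteRankBounds_of_nonneg hα hnonneg hpos⟩

theorem exists_generator_of_nonneg_of_eq_zero (hu : ∀ w ∈ inducedSet R f α, 0 ≤ u w)
    (hy : y ∈ inducedSet R f α) (hzero : u y = 0) :
    ∃ w ∈ inducedSet R f α, u w = 0 ∧
      (w = realPoint f ∨ ∃ j, w = realPoint f + (α j)⁻¹ • column R j) := by
  obtain ⟨y, hy, _, ⟨c, hc, hcα, rfl⟩, rfl⟩ := hy
  have hdouble := hu _ ⟨y, hy, _, ⟨2 • c, fun j => by simpa using hc j,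
    fun j hj => by simp [hcα j hj], rfl⟩, rfl⟩
  have hsum : ∑ j, (2 • c) j • column R j = (2 : ℝ) • ∑ j, c j • column R j := by
    simp [Finset.smul_sum, smul_smul]
  beta_reduce at hdouble hzero
  rw [hsum, affineMap_apply_add_smul, hzero] at hdouble
  have huy : u y ≤ 0 := by linarith
  obtain ⟨w, hw, hwy⟩ := (affineMap_concaveOn_univ u).exists_le_of_mem_convexHull (subset_univ _) hy
  have hmem : w ∈ inducedSet R f α := ⟨w, subset_convexHull ℝ _ hw, 0, ⟨0, by simp⟩, add_zero w⟩
  refine ⟨w, hmem, (hwy.trans huy).antisymm (hu w hmem), ?_⟩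
  rcases hw with ⟨j, -, rfl⟩ | rfl
  exacts [.inr ⟨j, rfl⟩, .inl rfl]

theorem IsLatticeFunctional.exists_ratCast_eq (hu : IsLatticeFunctional u) (x : Fin 2 → ℚ) :
    ∃ r : ℚ, (r : ℝ) = u (realPoint x) := by
  obtain ⟨π, π₀, hπ⟩ := hu.exists_coeff
  exact ⟨∑ i, π i * x i + π₀, by rw [hπ]; simp [realPoint]⟩

theorem IsLatticeFunctional.exists_ratCast_eq_of_apply_eq_zero (hX : IsLatticeFunctional X)
    (hY : IsLatticeFunctional Y) {x c : Fin 2 → ℚ} {t : ℝ} (hYx : Y (realPoint x) ≠ 0)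
    (hzero : Y (realPoint x + t • realPoint c) = 0) :
    ∃ r : ℚ, (r : ℝ) = X (realPoint x + t • realPoint c) := by
  have hadd : realPoint x + realPoint c = realPoint (x + c) := by ext; simp [realPoint]
  obtain ⟨r₁, hr₁⟩ := hX.exists_ratCast_eq x
  obtain ⟨r₂, hr₂⟩ := hX.exists_ratCast_eq (x + c)
  obtain ⟨s₁, hs₁⟩ := hY.exists_ratCast_eq x
  obtain ⟨s₂, hs₂⟩ := hY.exists_ratCast_eq (x + c)
  rw [affineMap_apply_add_smul, hadd, ← hs₁, ← hs₂] at hzero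
  rw [← hs₁] at hYx
  have hslope : (s₂ - s₁ : ℝ) ≠ 0 := fun h => hYx (by simpa [h] using hzero)
  have ht : t = -s₁ / (s₂ - s₁) := by
    rw [eq_div_iff hslope]
    linarith
  exact ⟨r₁ + -s₁ / (s₂ - s₁) * (r₂ - r₁), by
    rw [affineMap_apply_add_smul, hadd, ← hr₁, ← hr₂, ht]; push_cast; rfl⟩

theorem IsSideFunctional.exists_ratCast_eq_of_leftSide {v a b : Fin 2 → ℝ} {p : ℝ}
    (hside : IsSideFunctional (leftSide X Y p) v a b) (hbase : IsSideFunctional Y a b v)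
    (hX : IsLatticeFunctional X) (hY : IsLatticeFunctional Y)
    (hT : inducedSet R f α = convexHull ℝ {v, a, b}) (hf : 0 < Y (realPoint f)) :
    ∃ r : ℚ, (r : ℝ) = p := by
  have hbase_nonneg : ∀ w ∈ inducedSet R f α, 0 ≤ Y w := fun w hw =>
    hbase.nonneg_of_mem_convexHull (hT ▸ hw)
  have hside_nonneg : ∀ w ∈ inducedSet R f α, 0 ≤ leftSide X Y p w := fun w hw =>
    hside.nonneg_of_mem_convexHull (by rwa [insert_comm, pair_comm b a, ← hT])
  have ha : a ∈ inducedSet R f α := hT ▸ subset_convexHull ℝ _ (by simp)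
  obtain ⟨w, hw, hzero, hgen⟩ := exists_generator_of_nonneg_of_eq_zero
    (u := Y + leftSide X Y p) (fun w hw => add_nonneg (hbase_nonneg w hw) (hside_nonneg w hw)) ha
    (by rw [coe_add, Pi.add_apply, hbase.left, hside.right, add_zero])
  rw [coe_add, Pi.add_apply,
    add_eq_zero_iff_of_nonneg (hbase_nonneg w hw) (hside_nonneg w hw)] at hzero
  obtain ⟨hYw, hside_w⟩ := hzero
  rcases hgen with rfl | ⟨j, rfl⟩
  · exact absurd hYw hf.ne'
  · have hcolumn : column R j = realPoint fun i => R i j := rfl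
    rw [hcolumn] at hYw hside_w
    obtain ⟨r, hr⟩ := hX.exists_ratCast_eq_of_apply_eq_zero hY hf.ne' hYw
    refine ⟨-r, ?_⟩
    rw [leftSide_apply, hYw, ← hr] at hside_w
    push_cast
    linarith

end InducedSet

theorem mainTheorem3 (k : ℕ) (R : Matrix (Fin 2) (Fin k) ℚ) (f : Fin 2 → ℚ)
    (hR : ∀ j, column R j ≠ 0)
    (hf : realPoint f ∉ integerPoints 2)
    (hP : (mixedIntegerSet R f).Nonempty)
    (α : Fin k → ℝ) (hα : ∀ j, 0 ≤ α j)
    (hvalid : IsValidIneq (convexHull ℝ (mixedIntegerSet R f)) 0 (-α) (-1))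
    (hT : IsTriangleT2A (inducedSet R f α)) :
    splitRank (relaxation R f) 0 (-α) (-1) < ⊤ := by
  obtain ⟨v, a, b, hleftT, h⟩ := hT.exists_isT2AWithVertices
  obtain ⟨X, Y, hX, hY, p, q, hp, hq, hYside, hleft, hright, hab⟩ := h.exists_isLatticeFunctional
  have hrightT : inducedSet R f α = convexHull ℝ {v, b, a} := by rw [hleftT, pair_comm]
  have hcost : ∀ z ∈ mixedIntegerSet R f, 1 ≤ α ⬝ᵥ z.2 := fun z hz => by
    simpa [dotProduct] using hvalid z (subset_convexHull ℝ _ hz)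
  obtain ⟨hYf, hbaseBound⟩ := hYside.const_sub_mem_finiteRankBounds hα hcost hleftT hab
  obtain ⟨hleftf, hleftBound⟩ := hleft.const_sub_mem_finiteRankBounds hα hcost
    (by rw [hrightT, insert_comm]) h.left_existsUnique.exists
  obtain ⟨hrightf, hrightBound⟩ := hright.const_sub_mem_finiteRankBounds hα hcost
    (by rw [hleftT, insert_comm]) h.right_existsUnique.exists
  obtain ⟨p, rfl⟩ := hleft.exists_ratCast_eq_of_leftSide hYside hX hY hleftT hYf
  obtain ⟨q, rfl⟩ := IsSideFunctional.exists_ratCast_eq_of_leftSide hright hYside.symm hX.one_sub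
    hY hrightT hYf
  have hzero : const ℝ _ 0 ∈ finiteRankBounds (relaxation R f) α :=
    ⟨0, fun z hz => by simpa using dotProduct_nonneg_of_nonneg hα hz.2⟩
  exact splitRank_lt_top_of_const_mem <| const_one_mem_finiteRankBounds hX hY (mod_cast hp)
    (mod_cast hq) (inv_pos.2 hleftf) (inv_pos.2 hrightf) (inv_nonneg.2 hYf.le) hzero hleftBound
    hrightBound hbaseBound
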